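/- Let $\varrho_a,\varrho_b,\varrho_c$ be quantum states (density matrices) on finite-dimensional bipartite systems $B_2C_1$, $C_2A_1$ and $A_2B_1$ respectively, and let $\varrho_{\mathrm{BTN}}=\varrho_b\otimes\varrho_c\otimes\varrho_a$, regarded as a state of the three parties $A_1A_2$, $B_1B_2$, $C_1C_2$ (basic triangle network state). Let $\mathcal E_A,\mathcal E_B,\mathcal E_C$ be quantum channels (completely positive trace-preserving maps) from the systems $A_1A_2$, $B_1B_2$, $C_1C_2$ to finite-dimensional systems $A$, $B$, $C$, and let $\varrho=(\mathcal E_A\otimes\mathcal E_B\otimes\mathcal E_C)(\varrho_{\mathrm{BTN}})$ (a triangle network state with local channels, CTN). Let $\{A_i\}$, $\{B_j\}$, $\{C_k\}$ be finite families of observables (Hermitian matrices) on $A$, $B$, $C$, let $\{M_m\}$ be the family consisting of all $A_i\otimes\mathbb 1\otimes\mathbb 1$, $\mathbb 1\otimes B_j\otimes\mathbb 1$ and $\mathbb 1\otimes\mathbb 1\otimes C_k$, in this order, and let $\Gamma$ be its covariance matrix in the state $\varrho$, $$\Gamma_{mn}=\operatorname{tr}(M_mM_n\varrho)-\operatorname{tr}(M_m\varrho)\operatorname{tr}(M_n\varrho),\qquad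 \Gamma=\begin{pmatrix}\Gamma_A&\gamma_E&\gamma_F\\ \gamma_E^T&\Gamma_B&\gamma_G\\ \gamma_F^T&\gamma_G^T&\Gamma_C\end{pmatrix}.$$ Then $\operatorname{tr}(\Gamma)$ is real and $$\operatorname{tr}(\Gamma)\ \ge\ 2\|\gamma_E\|_{\mathrm{tr}}+2\|\gamma_F\|_{\mathrm{tr}}+2\|\gamma_G\|_{\mathrm{tr}},$$ where $\|X\|_{\mathrm{tr}}=\operatorname{tr}\sqrt{X^\dagger X}$ is the trace norm. In particular, a tripartite state violating this inequality for some choice of local observables cannot be prepared in the triangle network with local channels. -/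

import Mathlib

open scoped Kronecker ComplexOrder

namespace TriangleNetwork

/-- A density matrix (quantum state) on a finite-dimensional system. -/
structure IsDensityMatrix {n : Type*} [Fintype n] (ρ : Matrix n n ℂ) : Prop where
  posSemidef : ρ.PosSemidef
  trace_eq_one : ρ.trace = 1

/-- The tensor product `Φ ⊗ Ψ` of two linear maps between matrix algebras, where the tensor
product of matrices is realised as the Kronecker product: `(Φ ⊗ Ψ) (X ⊗ Y) = Φ X ⊗ Ψ Y`. -/
noncomputable def tensorMap {m m' n n' : Type*} [Fintype m] [Fintype m'] [Fintype n] [Fintype n']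
    [DecidableEq m] [DecidableEq m'] [DecidableEq n] [DecidableEq n']
    (Φ : Matrix m m ℂ →ₗ[ℂ] Matrix m' m' ℂ) (Ψ : Matrix n n ℂ →ₗ[ℂ] Matrix n' n' ℂ) :
    Matrix (m × n) (m × n) ℂ →ₗ[ℂ] Matrix (m' × n') (m' × n') ℂ :=
  (kroneckerLinearEquiv m' m' n' n' ℂ).toLinearMap ∘ₗ TensorProduct.map Φ Ψ ∘ₗ
    (kroneckerLinearEquiv m m n n ℂ).symm.toLinearMap

/-- A quantum channel: a completely positive and trace preserving linear map. -/
structure IsChannel {m n : Type*} [Fintype m] [Fintype n] [DecidableEq m] [DecidableEq n]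
    (Φ : Matrix m m ℂ →ₗ[ℂ] Matrix n n ℂ) : Prop where
  completelyPositive : ∀ (k : ℕ) (X : Matrix (Fin k × m) (Fin k × m) ℂ), X.PosSemidef →
    (tensorMap (LinearMap.id : Matrix (Fin k) (Fin k) ℂ →ₗ[ℂ] Matrix (Fin k) (Fin k) ℂ)
      Φ X).PosSemidef
  tracePreserving : ∀ X : Matrix m m ℂ, (Φ X).trace = X.trace

/-- The state `ρ_b ⊗ ρ_c ⊗ ρ_a` of the basic triangle network. The source states live on
`C₂ A₁`, `A₂ B₁` and `B₂ C₁` respectively; the factors of the global system are regrouped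
as `(A₁ A₂) (B₁ B₂) (C₁ C₂)`. -/
def btnState {A₁ A₂ B₁ B₂ C₁ C₂ : Type*} (ρb : Matrix (C₂ × A₁) (C₂ × A₁) ℂ)
    (ρc : Matrix (A₂ × B₁) (A₂ × B₁) ℂ) (ρa : Matrix (B₂ × C₁) (B₂ × C₁) ℂ) :
    Matrix ((A₁ × A₂) × (B₁ × B₂) × (C₁ × C₂)) ((A₁ × A₂) × (B₁ × B₂) × (C₁ × C₂)) ℂ :=
  (ρb ⊗ₖ (ρc ⊗ₖ ρa)).submatrix
    (fun x => ((x.2.2.2, x.1.1), (x.1.2, x.2.1.1), (x.2.1.2, x.2.2.1)))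
    (fun x => ((x.2.2.2, x.1.1), (x.1.2, x.2.1.1), (x.2.1.2, x.2.2.1)))

/-- `ρ` is preparable in the triangle network with local channels: there are three
finite-dimensional bipartite source states and three local channels such that
`ρ = (E_A ⊗ E_B ⊗ E_C) (ρ_BTN)`. -/
def IsCTNState {A B C : Type*} [Fintype A] [Fintype B] [Fintype C]
    [DecidableEq A] [DecidableEq B] [DecidableEq C]
    (ρ : Matrix (A × B × C) (A × B × C) ℂ) : Prop :=
  ∃ (a₁ a₂ b₁ b₂ c₁ c₂ : ℕ)
    (ρb : Matrix (Fin c₂ × Fin a₁) (Fin c₂ × Fin a₁) ℂ)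
    (ρc : Matrix (Fin a₂ × Fin b₁) (Fin a₂ × Fin b₁) ℂ)
    (ρa : Matrix (Fin b₂ × Fin c₁) (Fin b₂ × Fin c₁) ℂ)
    (EA : Matrix (Fin a₁ × Fin a₂) (Fin a₁ × Fin a₂) ℂ →ₗ[ℂ] Matrix A A ℂ)
    (EB : Matrix (Fin b₁ × Fin b₂) (Fin b₁ × Fin b₂) ℂ →ₗ[ℂ] Matrix B B ℂ)
    (EC : Matrix (Fin c₁ × Fin c₂) (Fin c₁ × Fin c₂) ℂ →ₗ[ℂ] Matrix C C ℂ),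
    IsDensityMatrix ρb ∧ IsDensityMatrix ρc ∧ IsDensityMatrix ρa ∧
    IsChannel EA ∧ IsChannel EB ∧ IsChannel EC ∧
    ρ = tensorMap EA (tensorMap EB EC) (btnState ρb ρc ρa)

/-- The expectation value `⟨X⟩_ρ = tr (X ρ)`. -/
def expect {n : Type*} [Fintype n] (X ρ : Matrix n n ℂ) : ℂ := (X * ρ).trace

/-- The covariance matrix of the observables `M i` in the state `ρ`, with entries
`⟨M i * M j⟩_ρ - ⟨M i⟩_ρ * ⟨M j⟩_ρ`. -/
def covMatrix {n ι : Type*} [Fintype n] (M : ι → Matrix n n ℂ) (ρ : Matrix n n ℂ) :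
    Matrix ι ι ℂ :=
  Matrix.of fun i j => expect (M i * M j) ρ - expect (M i) ρ * expect (M j) ρ

/-- The family of observables `A i ⊗ 1 ⊗ 1`, `1 ⊗ B j ⊗ 1`, `1 ⊗ 1 ⊗ C k`. -/
def localObservables {α β γ ι κ μ : Type*} [DecidableEq α] [DecidableEq β] [DecidableEq γ]
    (A : ι → Matrix α α ℂ) (B : κ → Matrix β β ℂ) (C : μ → Matrix γ γ ℂ) :
    ι ⊕ κ ⊕ μ → Matrix (α × β × γ) (α × β × γ) ℂ
  | .inl i => A i ⊗ₖ ((1 : Matrix β β ℂ) ⊗ₖ (1 : Matrix γ γ ℂ))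
  | .inr (.inl j) => (1 : Matrix α α ℂ) ⊗ₖ (B j ⊗ₖ (1 : Matrix γ γ ℂ))
  | .inr (.inr k) => (1 : Matrix α α ℂ) ⊗ₖ ((1 : Matrix β β ℂ) ⊗ₖ C k)

/-- The `A`-`B` off-diagonal block of a `3 × 3` block matrix. -/
def blockE {ι κ μ : Type*} (Γ : Matrix (ι ⊕ κ ⊕ μ) (ι ⊕ κ ⊕ μ) ℂ) : Matrix ι κ ℂ :=
  Γ.submatrix Sum.inl (fun j => Sum.inr (Sum.inl j))

/-- The `A`-`C` off-diagonal block of a `3 × 3` block matrix. -/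
def blockF {ι κ μ : Type*} (Γ : Matrix (ι ⊕ κ ⊕ μ) (ι ⊕ κ ⊕ μ) ℂ) : Matrix ι μ ℂ :=
  Γ.submatrix Sum.inl (fun k => Sum.inr (Sum.inr k))

/-- The `B`-`C` off-diagonal block of a `3 × 3` block matrix. -/
def blockG {ι κ μ : Type*} (Γ : Matrix (ι ⊕ κ ⊕ μ) (ι ⊕ κ ⊕ μ) ℂ) : Matrix κ μ ℂ :=
  Γ.submatrix (fun j => Sum.inr (Sum.inl j)) (fun k => Sum.inr (Sum.inr k))

/-- The trace norm `tr √(Mᴴ M)`, i.e. the sum of the singular values of `M`: the square roots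
of the eigenvalues (with multiplicity) of `Mᴴ M`. -/
noncomputable def traceNorm {m n : Type*} [Fintype m] [Fintype n] [DecidableEq n]
    (M : Matrix m n ℂ) : ℝ :=
  ∑ i, √((Matrix.isHermitian_conjTranspose_mul_self M).eigenvalues i)

end TriangleNetwork

open TriangleNetwork

/-!
The idea is to distribute the variances of the local observables over the three sources.

In the Heisenberg picture a channel `E` acts on observables by a unital map `F` with
`F(A)² ≤ F(A²)` (Kadison–Schwarz, `IsChannel.exists_dual`, from a Kraus representation). Hence
replacing the observables of `ρ` by their images on the basic triangle network keeps the
cross-covariances between different parties and can only lower the variances.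

In the basic triangle network each party holds two systems in a product state. An observable `X` of
that party has two partial expectations `p` and `q`, one on each system, and Bessel's inequality
gives `var p + var q ≤ var X` (`IsState.cov_condFst_add_cov_condSnd_le`). Two parties share exactly
one source, so their cross-covariance equals the cross-covariance, in that source, of the partial
expectations living on it (`expectation_btnState_AB` and its two analogues). Each source thus
carries a covariance matrix with the prescribed off-diagonal block, and the three traces add up to
at most `tr Γ`.

Finally, a covariance matrix is positive semidefinite, and for a positive semidefinite block matrix
the trace is at least twice the trace norm of the off-diagonal block: test the matrix on the
singular vectors of that block (`two_mul_traceNorm_toBlocks₁₂_le`).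
-/

set_option linter.unusedSectionVars false

namespace TriangleNetwork

open Matrix

/-! ### The trace norm of an off-diagonal block -/

/-- Compressing a positive semidefinite matrix by a partial isometry does not increase its trace. -/
lemma trace_conjTranspose_mul_mul_le {m k : Type*} [Fintype m] [Fintype k]
    {X : Matrix m m ℂ} (hX : X.PosSemidef) {W : Matrix m k ℂ} (hW : W * Wᴴ * W = W) :
    (Wᴴ * X * W).trace ≤ X.trace := by
  classical
  have h := (hX.conjTranspose_mul_mul_same (1 - W * Wᴴ)).trace_nonneg
  have hP : (1 - W * Wᴴ) * (1 - W * Wᴴ)ᴴ = 1 - W * Wᴴ := by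
    simp only [conjTranspose_sub, conjTranspose_one, conjTranspose_mul,
      conjTranspose_conjTranspose]
    rw [Matrix.mul_sub, Matrix.sub_mul, Matrix.sub_mul, Matrix.mul_one, Matrix.mul_one,
      Matrix.one_mul, ← Matrix.mul_assoc, hW, sub_self, sub_zero]
  rw [trace_mul_cycle, hP, Matrix.sub_mul, Matrix.one_mul, trace_sub, Matrix.mul_assoc,
    trace_mul_comm W] at h
  exact sub_nonneg.1 h

/-- The trace of a positive semidefinite `2 × 2` block matrix is at least twice the trace norm of
its off-diagonal block `g`. If `g V = W S` pairs right singular vectors (columns of `V`) with left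
ones (columns of `W`), then the compression of the matrix by `[-W; V]` has nonnegative trace. -/
theorem two_mul_traceNorm_toBlocks₁₂_le {m n : Type*} [Fintype m] [Fintype n] [DecidableEq n]
    {M : Matrix (m ⊕ n) (m ⊕ n) ℂ} (hM : M.PosSemidef) :
    (2 * traceNorm M.toBlocks₁₂ : ℂ) ≤ M.toBlocks₁₁.trace + M.toBlocks₂₂.trace := by
  set X := M.toBlocks₁₁ with hX
  set Y := M.toBlocks₂₂ with hY
  set g := M.toBlocks₁₂ with hg
  have hg' : M.toBlocks₂₁ = gᴴ := by
    ext i j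
    exact (hM.1.apply _ _).symm
  have hXp : X.PosSemidef := hM.submatrix Sum.inl
  have hH := isHermitian_conjTranspose_mul_self g
  set l := hH.eigenvalues with hl
  have hl0 : ∀ i, 0 ≤ l i := eigenvalues_conjTranspose_mul_self_nonneg g
  set V : Matrix n n ℂ := hH.eigenvectorUnitary.1 with hV
  have hVV : V * Vᴴ = 1 := Unitary.coe_mul_star_self hH.eigenvectorUnitary
  have hdiag : Vᴴ * (gᴴ * g) * V = diagonal (fun i => (l i : ℂ)) := by
    have := hH.conjStarAlgAut_star_eigenvectorUnitary
    rw [Unitary.conjStarAlgAut_star_apply] at this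
    simpa [Function.comp_def, star_eq_conjTranspose, Matrix.mul_assoc] using this
  -- The left singular vectors of `g` are `g v / s` for the nonzero singular values `s`; on the
  -- kernel of `g` the convention `0⁻¹ = 0` makes the columns vanish.
  set D : Matrix n n ℂ := diagonal (fun i => (((√(l i))⁻¹ : ℝ) : ℂ)) with hD
  have hDH : Dᴴ = D := by
    rw [hD, diagonal_conjTranspose]
    congr 1; ext i; simp
  set W : Matrix m n ℂ := g * V * D with hWdef
  have hWg : Wᴴ * g * V = diagonal (fun i => ((√(l i) : ℝ) : ℂ)) := by
    have : Wᴴ * g * V = D * (Vᴴ * (gᴴ * g) * V) := by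
      simp only [hWdef, conjTranspose_mul, hDH, Matrix.mul_assoc]
    rw [this, hdiag, hD, diagonal_mul_diagonal]
    congr 1; ext i
    rw [← Complex.ofReal_mul]
    congr 1
    rcases eq_or_ne (√(l i)) 0 with h | h
    · simp [h]
    · field_simp
      rw [Real.sq_sqrt (hl0 i)]
  have hW : W * Wᴴ * W = W := by
    have h1 : W * Wᴴ * W = W * (Wᴴ * g * V * D) := by
      conv_lhs => rw [hWdef]
      simp only [hWdef, Matrix.mul_assoc]
    have h2 : W * (Wᴴ * g * V * D) = g * V * (D * (Wᴴ * g * V * D)) := by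
      simp only [hWdef, Matrix.mul_assoc]
    rw [h1, h2, hWg, hD, diagonal_mul_diagonal, diagonal_mul_diagonal, hWdef]
    congr 2; ext i
    rw [← Complex.ofReal_mul, ← Complex.ofReal_mul]
    congr 1
    rcases eq_or_ne (√(l i)) 0 with h | h
    · simp [h]
    · field_simp
  have key := (hM.conjTranspose_mul_mul_same (fromRows (-W) V)).trace_nonneg
  have hMb : M = fromBlocks X g gᴴ Y := by
    rw [← hg', hX, hg, hY, fromBlocks_toBlocks]
  have hexp : (fromRows (-W) V)ᴴ * M * fromRows (-W) V
      = Wᴴ * X * W + Vᴴ * Y * V - Wᴴ * g * V - (Wᴴ * g * V)ᴴ := by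
    rw [hMb, conjTranspose_fromRows_eq_fromCols_conjTranspose, fromCols_mul_fromBlocks,
      fromCols_mul_fromRows]
    simp only [conjTranspose_neg, conjTranspose_mul, conjTranspose_conjTranspose, Matrix.add_mul,
      Matrix.neg_mul, Matrix.mul_neg, Matrix.mul_assoc]
    abel
  have hY' : (Vᴴ * Y * V).trace = Y.trace := by
    rw [trace_mul_cycle, hVV, Matrix.one_mul]
  have htr : (Wᴴ * g * V).trace = (traceNorm g : ℂ) := by
    rw [hWg, trace_diagonal, traceNorm, Complex.ofReal_sum]
  rw [hexp, trace_sub, trace_sub, trace_add, trace_conjTranspose, hY', htr] at key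
  have h3 := trace_conjTranspose_mul_mul_le hXp hW
  have h4 : star (traceNorm g : ℂ) = traceNorm g := Complex.conj_ofReal _
  rw [h4] at key
  calc (2 * traceNorm g : ℂ) ≤ 2 * traceNorm g +
        ((Wᴴ * X * W).trace + Y.trace - traceNorm g - traceNorm g) := le_add_of_nonneg_right key
    _ = (Wᴴ * X * W).trace + Y.trace := by ring
    _ ≤ X.trace + Y.trace := by gcongr

/-! ### States as positive functionals and their covariances -/

/-- A state of a matrix algebra, as a unital positive linear functional `X ↦ tr (X ρ)`. In this
form reduced states are obtained by composition, and no partial trace is needed. -/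
structure IsState {n : Type*} [Fintype n] [DecidableEq n] (φ : Matrix n n ℂ →ₗ[ℂ] ℂ) : Prop where
  map_one : φ 1 = 1
  map_conjTranspose : ∀ X, φ Xᴴ = star (φ X)
  nonneg : ∀ X, 0 ≤ φ (Xᴴ * X)

/-- The covariance `φ (X Y) - φ X φ Y` of two observables in a state. -/
def cov {n : Type*} [Fintype n] (φ : Matrix n n ℂ →ₗ[ℂ] ℂ) (X Y : Matrix n n ℂ) : ℂ :=
  φ (X * Y) - φ X * φ Y

/-- The functional `X ↦ tr (X ρ)` of a matrix `ρ`. -/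
def expectation {n : Type*} [Fintype n] (ρ : Matrix n n ℂ) : Matrix n n ℂ →ₗ[ℂ] ℂ where
  toFun X := expect X ρ
  map_add' X Y := by simp [expect, Matrix.add_mul]
  map_smul' c X := by simp [expect]

@[simp] lemma expectation_apply {n : Type*} [Fintype n] (ρ X : Matrix n n ℂ) :
    expectation ρ X = (X * ρ).trace := rfl

section State
variable {n : Type*} [Fintype n] [DecidableEq n]

lemma IsDensityMatrix.isState {ρ : Matrix n n ℂ} (hρ : IsDensityMatrix ρ) :
    IsState (expectation ρ) where
  map_one := by simp [hρ.trace_eq_one]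
  map_conjTranspose X := by
    rw [expectation_apply, expectation_apply, ← trace_conjTranspose, conjTranspose_mul,
      hρ.posSemidef.1.eq, trace_mul_comm]
  nonneg X := by
    rw [expectation_apply, Matrix.mul_assoc, trace_mul_comm]
    exact (hρ.posSemidef.mul_mul_conjTranspose_same X).trace_nonneg

variable {φ : Matrix n n ℂ →ₗ[ℂ] ℂ}

lemma IsState.nonneg_of_posSemidef (hφ : IsState φ) {X : Matrix n n ℂ} (hX : X.PosSemidef) :
    0 ≤ φ X := by
  open scoped MatrixOrder in
  obtain ⟨B, rfl⟩ := CStarAlgebra.nonneg_iff_eq_star_mul_self.1 hX.nonneg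
  exact hφ.nonneg B

lemma IsState.star_apply (hφ : IsState φ) {X : Matrix n n ℂ} (hX : X.IsHermitian) :
    star (φ X) = φ X := by
  rw [← hφ.map_conjTranspose, hX.eq]

lemma IsState.cov_posSemidef (hφ : IsState φ) {ι : Type*} [Fintype ι] {f : ι → Matrix n n ℂ}
    (hf : ∀ i, (f i).IsHermitian) : (Matrix.of fun i j => cov φ (f i) (f j)).PosSemidef := by
  rw [posSemidef_iff_dotProduct_mulVec]
  refine ⟨?_, fun x => ?_⟩
  · ext i j
    simp only [conjTranspose_apply, of_apply, cov, star_sub, star_mul']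
    rw [hφ.star_apply (hf i), hφ.star_apply (hf j), ← hφ.map_conjTranspose, conjTranspose_mul,
      (hf i).eq, (hf j).eq, mul_comm (φ (f j))]
  · have h := hφ.nonneg (∑ i, x i • (f i - φ (f i) • 1))
    convert h using 1
    have hs : (∑ i, x i • (f i - φ (f i) • (1 : Matrix n n ℂ)))ᴴ =
        ∑ i, star (x i) • (f i - φ (f i) • (1 : Matrix n n ℂ)) := by
      rw [conjTranspose_sum]
      refine Finset.sum_congr rfl fun i _ => ?_
      rw [conjTranspose_smul, conjTranspose_sub, conjTranspose_smul, conjTranspose_one, (hf i).eq,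
        hφ.star_apply (hf i)]
    rw [hs, Finset.sum_mul_sum]
    simp only [map_sum, dotProduct, mulVec, Finset.mul_sum, of_apply, Pi.star_apply]
    refine Finset.sum_congr rfl fun i _ => Finset.sum_congr rfl fun j _ => ?_
    simp only [cov, Matrix.smul_mul, Matrix.mul_smul, Matrix.sub_mul, Matrix.mul_sub,
      Matrix.one_mul, Matrix.mul_one, map_smul, map_sub, hφ.map_one, smul_eq_mul]
    ring

theorem IsState.two_mul_traceNorm_cov_le (hφ : IsState φ) {ι κ : Type*} [Fintype ι] [Fintype κ]
    [DecidableEq κ] {a : ι → Matrix n n ℂ} {b : κ → Matrix n n ℂ}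
    (ha : ∀ i, (a i).IsHermitian) (hb : ∀ j, (b j).IsHermitian) :
    (2 * traceNorm (Matrix.of fun i j => cov φ (a i) (b j)) : ℂ) ≤
      ∑ i, cov φ (a i) (a i) + ∑ j, cov φ (b j) (b j) := by
  have hf : ∀ s, (Sum.elim a b s).IsHermitian := by
    rintro (i | j)
    exacts [ha i, hb j]
  have h := two_mul_traceNorm_toBlocks₁₂_le (hφ.cov_posSemidef hf)
  exact h

end State

/-! ### Reduced states and partial expectations -/

section Slice
variable {m n : Type*} [Fintype m] [Fintype n] [DecidableEq m] [DecidableEq n]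

lemma kronecker_induction {p : Matrix (m × n) (m × n) ℂ → Prop}
    (kron : ∀ P Q, p (P ⊗ₖ Q)) (add : ∀ X Y, p X → p Y → p (X + Y)) (X) : p X := by
  obtain ⟨t, rfl⟩ := (kroneckerLinearEquiv m m n n ℂ).surjective X
  induction t with
  | zero => simpa using kron 0 0
  | tmul P Q => exact kron P Q
  | add s t hs ht => rw [map_add]; exact add _ _ hs ht

/-- The embedding `P ↦ P ⊗ 1` of the observables of the first factor. -/
def inFst (n : Type*) [DecidableEq n] :
    Matrix m m ℂ →ₗ[ℂ] Matrix (m × n) (m × n) ℂ where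
  toFun P := P ⊗ₖ (1 : Matrix n n ℂ)
  map_add' P Q := add_kronecker P Q 1
  map_smul' c P := smul_kronecker c P 1

/-- The embedding `Q ↦ 1 ⊗ Q` of the observables of the second factor. -/
def inSnd (m : Type*) [DecidableEq m] :
    Matrix n n ℂ →ₗ[ℂ] Matrix (m × n) (m × n) ℂ where
  toFun Q := (1 : Matrix m m ℂ) ⊗ₖ Q
  map_add' P Q := kronecker_add 1 P Q
  map_smul' c P := kronecker_smul c 1 P

lemma inFst_apply (P : Matrix m m ℂ) : inFst n P = P ⊗ₖ 1 := rfl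

lemma inSnd_apply (Q : Matrix n n ℂ) : inSnd m Q = 1 ⊗ₖ Q := rfl

@[simp] lemma inFst_one : inFst n (1 : Matrix m m ℂ) = 1 := one_kronecker_one

@[simp] lemma inSnd_one : inSnd m (1 : Matrix n n ℂ) = 1 := one_kronecker_one

lemma inFst_mul (P Q : Matrix m m ℂ) : inFst n (P * Q) = inFst n P * inFst n Q := by
  simp [inFst_apply, ← mul_kronecker_mul]

lemma inSnd_mul (P Q : Matrix n n ℂ) : inSnd m (P * Q) = inSnd m P * inSnd m Q := by
  simp [inSnd_apply, ← mul_kronecker_mul]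

lemma inFst_mul_inSnd (P : Matrix m m ℂ) (Q : Matrix n n ℂ) :
    inFst n P * inSnd m Q = P ⊗ₖ Q := by
  simp [inFst_apply, inSnd_apply, ← mul_kronecker_mul]

lemma inSnd_mul_inFst (P : Matrix m m ℂ) (Q : Matrix n n ℂ) :
    inSnd m Q * inFst n P = P ⊗ₖ Q := by
  simp [inFst_apply, inSnd_apply, ← mul_kronecker_mul]

lemma inFst_conjTranspose (P : Matrix m m ℂ) : inFst n Pᴴ = (inFst n P)ᴴ := by
  simp [inFst_apply, conjTranspose_kronecker]

lemma inSnd_conjTranspose (P : Matrix n n ℂ) : inSnd m Pᴴ = (inSnd m P)ᴴ := by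
  simp [inSnd_apply, conjTranspose_kronecker]

lemma isHermitian_inFst {P : Matrix m m ℂ} (hP : P.IsHermitian) : (inFst n P).IsHermitian := by
  rw [Matrix.IsHermitian, ← inFst_conjTranspose, hP.eq]

lemma isHermitian_inSnd {P : Matrix n n ℂ} (hP : P.IsHermitian) : (inSnd m P).IsHermitian := by
  rw [Matrix.IsHermitian, ← inSnd_conjTranspose, hP.eq]

/-- The reduced state on the first factor. -/
def reduceFst (φ : Matrix (m × n) (m × n) ℂ →ₗ[ℂ] ℂ) : Matrix m m ℂ →ₗ[ℂ] ℂ := φ ∘ₗ inFst n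

/-- The reduced state on the second factor. -/
def reduceSnd (φ : Matrix (m × n) (m × n) ℂ →ₗ[ℂ] ℂ) : Matrix n n ℂ →ₗ[ℂ] ℂ := φ ∘ₗ inSnd m

lemma reduceFst_apply (φ : Matrix (m × n) (m × n) ℂ →ₗ[ℂ] ℂ) (P : Matrix m m ℂ) :
    reduceFst φ P = φ (inFst n P) := rfl

lemma reduceSnd_apply (φ : Matrix (m × n) (m × n) ℂ →ₗ[ℂ] ℂ) (Q : Matrix n n ℂ) :
    reduceSnd φ Q = φ (inSnd m Q) := rfl

lemma IsState.reduceFst {φ : Matrix (m × n) (m × n) ℂ →ₗ[ℂ] ℂ} (hφ : IsState φ) :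
    IsState (reduceFst φ) where
  map_one := by rw [reduceFst_apply, inFst_one, hφ.map_one]
  map_conjTranspose X := by
    rw [reduceFst_apply, inFst_conjTranspose, hφ.map_conjTranspose, reduceFst_apply]
  nonneg X := by
    rw [reduceFst_apply, inFst_mul, inFst_conjTranspose]
    exact hφ.nonneg _

lemma IsState.reduceSnd {φ : Matrix (m × n) (m × n) ℂ →ₗ[ℂ] ℂ} (hφ : IsState φ) :
    IsState (reduceSnd φ) where
  map_one := by rw [reduceSnd_apply, inSnd_one, hφ.map_one]
  map_conjTranspose X := by
    rw [reduceSnd_apply, inSnd_conjTranspose, hφ.map_conjTranspose, reduceSnd_apply]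
  nonneg X := by
    rw [reduceSnd_apply, inSnd_mul, inSnd_conjTranspose]
    exact hφ.nonneg _

lemma cov_reduceFst (φ : Matrix (m × n) (m × n) ℂ →ₗ[ℂ] ℂ) (X Y : Matrix m m ℂ) :
    cov (reduceFst φ) X Y = cov φ (inFst n X) (inFst n Y) := by
  simp only [cov, reduceFst_apply, inFst_mul]

lemma cov_reduceSnd (φ : Matrix (m × n) (m × n) ℂ →ₗ[ℂ] ℂ) (X Y : Matrix n n ℂ) :
    cov (reduceSnd φ) X Y = cov φ (inSnd m X) (inSnd m Y) := by
  simp only [cov, reduceSnd_apply, inSnd_mul]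

/-- The partial expectation over the second factor: `P ⊗ Q ↦ ψ Q • P`. -/
def condFst (ψ : Matrix n n ℂ →ₗ[ℂ] ℂ) : Matrix (m × n) (m × n) ℂ →ₗ[ℂ] Matrix m m ℂ where
  toFun X := Matrix.of fun a b => ψ (Matrix.of fun i j => X (a, i) (b, j))
  map_add' X Y := by
    ext a b
    exact ψ.map_add (Matrix.of fun i j => X (a, i) (b, j)) (Matrix.of fun i j => Y (a, i) (b, j))
  map_smul' c X := by
    ext a b
    exact ψ.map_smul c (Matrix.of fun i j => X (a, i) (b, j))

/-- The partial expectation over the first factor: `P ⊗ Q ↦ φ P • Q`. -/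
def condSnd (φ : Matrix m m ℂ →ₗ[ℂ] ℂ) : Matrix (m × n) (m × n) ℂ →ₗ[ℂ] Matrix n n ℂ where
  toFun X := Matrix.of fun i j => φ (Matrix.of fun a b => X (a, i) (b, j))
  map_add' X Y := by
    ext i j
    exact φ.map_add (Matrix.of fun a b => X (a, i) (b, j)) (Matrix.of fun a b => Y (a, i) (b, j))
  map_smul' c X := by
    ext i j
    exact φ.map_smul c (Matrix.of fun a b => X (a, i) (b, j))

lemma condFst_kronecker (ψ : Matrix n n ℂ →ₗ[ℂ] ℂ) (P : Matrix m m ℂ) (Q : Matrix n n ℂ) :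
    condFst ψ (P ⊗ₖ Q) = ψ Q • P := by
  ext a b
  rw [Matrix.smul_apply, smul_eq_mul, mul_comm, ← smul_eq_mul, ← map_smul]
  rfl

lemma condSnd_kronecker (φ : Matrix m m ℂ →ₗ[ℂ] ℂ) (P : Matrix m m ℂ) (Q : Matrix n n ℂ) :
    condSnd φ (P ⊗ₖ Q) = φ P • Q := by
  ext i j
  rw [Matrix.smul_apply, smul_eq_mul, mul_comm, ← smul_eq_mul, ← map_smul]
  change φ _ = φ _
  congr 1
  ext a b
  exact mul_comm _ _

lemma IsState.condFst_one {ψ : Matrix n n ℂ →ₗ[ℂ] ℂ} (hψ : IsState ψ) :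
    condFst ψ (1 : Matrix (m × n) (m × n) ℂ) = 1 := by
  rw [← one_kronecker_one, condFst_kronecker, hψ.map_one, one_smul]

lemma IsState.condSnd_one {φ : Matrix m m ℂ →ₗ[ℂ] ℂ} (hφ : IsState φ) :
    condSnd φ (1 : Matrix (m × n) (m × n) ℂ) = 1 := by
  rw [← one_kronecker_one, condSnd_kronecker, hφ.map_one, one_smul]

lemma IsState.isHermitian_condFst {ψ : Matrix n n ℂ →ₗ[ℂ] ℂ} (hψ : IsState ψ)
    {X : Matrix (m × n) (m × n) ℂ} (hX : X.IsHermitian) : (condFst ψ X).IsHermitian := by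
  ext a b
  change star (ψ _) = ψ _
  rw [← hψ.map_conjTranspose]
  congr 1
  ext i j
  exact hX.apply _ _

lemma IsState.isHermitian_condSnd {φ : Matrix m m ℂ →ₗ[ℂ] ℂ} (hφ : IsState φ)
    {X : Matrix (m × n) (m × n) ℂ} (hX : X.IsHermitian) : (condSnd φ X).IsHermitian := by
  ext i j
  change star (φ _) = φ _
  rw [← hφ.map_conjTranspose]
  congr 1
  ext a b
  exact hX.apply _ _

/-- In a product state the variance of an observable is at least the sum of the variances of its
two partial expectations. This is Bessel's inequality for the semi-inner product
`(X, Y) ↦ ω (Xᴴ Y)`: the centred partial expectations `p ⊗ 1` and `1 ⊗ q` are orthogonal, and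
they are the projections of the centred observable onto the algebras of the two factors. -/
theorem IsState.cov_condFst_add_cov_condSnd_le {ω : Matrix (m × n) (m × n) ℂ →ₗ[ℂ] ℂ}
    (hω : IsState ω) {φ : Matrix m m ℂ →ₗ[ℂ] ℂ} {ψ : Matrix n n ℂ →ₗ[ℂ] ℂ}
    (hφ : IsState φ) (hψ : IsState ψ) (h : ∀ P Q, ω (P ⊗ₖ Q) = φ P * ψ Q)
    {X : Matrix (m × n) (m × n) ℂ} (hX : X.IsHermitian) :
    cov φ (condFst ψ X) (condFst ψ X) + cov ψ (condSnd φ X) (condSnd φ X) ≤ cov ω X X := by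
  have hp : ∀ (Z : Matrix (m × n) (m × n) ℂ) (P : Matrix m m ℂ),
      ω (Z * inFst n P) = φ (condFst ψ Z * P) ∧ ω (inFst n P * Z) = φ (P * condFst ψ Z) := by
    intro Z P
    induction Z using kronecker_induction with
    | kron A B =>
      simp [inFst_apply, ← mul_kronecker_mul, h, condFst_kronecker, mul_comm]
    | add Y Z hY hZ => simp [add_mul, mul_add, hY, hZ]
  have hq : ∀ (Z : Matrix (m × n) (m × n) ℂ) (Q : Matrix n n ℂ),
      ω (Z * inSnd m Q) = ψ (condSnd φ Z * Q) ∧ ω (inSnd m Q * Z) = ψ (Q * condSnd φ Z) := by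
    intro Z Q
    induction Z using kronecker_induction with
    | kron A B =>
      simp [inSnd_apply, ← mul_kronecker_mul, h, condSnd_kronecker]
    | add Y Z hY hZ => simp [add_mul, mul_add, hY, hZ]
  set p := condFst ψ X with hpdef
  set q := condSnd φ X with hqdef
  have hpH : p.IsHermitian := hψ.isHermitian_condFst hX
  have hqH : q.IsHermitian := hφ.isHermitian_condSnd hX
  set x := ω X with hx
  have hpx : φ p = x := by simpa using ((hp X 1).1).symm
  have hqx : ψ q = x := by simpa using ((hq X 1).1).symm
  have hxs : star x = x := hω.star_apply hX
  -- The part of `X` orthogonal to both factors: the centring constants `-x + x + x` combine.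
  set R := X - inFst n p - inSnd m q + x • (1 : Matrix (m × n) (m × n) ℂ) with hR
  have hRH : Rᴴ = R := by
    simp only [hR, conjTranspose_add, conjTranspose_sub, conjTranspose_smul, conjTranspose_one,
      ← inFst_conjTranspose, ← inSnd_conjTranspose, hX.eq, hpH.eq, hqH.eq, hxs]
  have key := hω.nonneg R
  rw [hRH] at key
  have hpp : ω (inFst n p) = x := by rw [← hpx]; simpa using (hp 1 p).1.trans (by
    rw [hψ.condFst_one, Matrix.one_mul])
  have hqq : ω (inSnd m q) = x := by rw [← hqx]; simpa using (hq 1 q).1.trans (by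
    rw [hφ.condSnd_one, Matrix.one_mul])
  have e1 : ω (inFst n p * inFst n p) = φ (p * p) := by
    rw [(hp _ _).1, inFst_apply, condFst_kronecker, hψ.map_one, one_smul]
  have e2 : ω (inSnd m q * inSnd m q) = ψ (q * q) := by
    rw [(hq _ _).1, inSnd_apply, condSnd_kronecker, hφ.map_one, one_smul]
  have e3 : ω (inFst n p * inSnd m q) = x * x := by
    rw [inFst_mul_inSnd, h, hpx, hqx]
  have e4 : ω (inSnd m q * inFst n p) = x * x := by
    rw [inSnd_mul_inFst, h, hpx, hqx]
  have hexp : ω (R * R) = cov ω X X - (cov φ p p + cov ψ q q) := by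
    simp only [hR, Matrix.add_mul, Matrix.mul_add, Matrix.sub_mul, Matrix.mul_sub,
      Matrix.smul_mul, Matrix.mul_smul, Matrix.one_mul, Matrix.mul_one, map_add, map_sub,
      map_smul, smul_eq_mul, (hp X p).1, (hp X p).2, (hq X q).1, (hq X q).2, ← hpdef, ← hqdef,
      e1, e2, e3, e4, hpp, hqq, ← hx, hω.map_one, cov, hpx, hqx]
    ring
  rw [hexp] at key
  exact sub_nonneg.1 key

end Slice

/-! ### Channels in the Heisenberg picture -/

section Channel
variable {m n : Type*} [Fintype m] [Fintype n] [DecidableEq m] [DecidableEq n]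

@[simp] lemma tensorMap_kronecker {m' n' : Type*} [Fintype m'] [Fintype n'] [DecidableEq m']
    [DecidableEq n'] (Φ : Matrix m m ℂ →ₗ[ℂ] Matrix m' m' ℂ) (Ψ : Matrix n n ℂ →ₗ[ℂ] Matrix n' n' ℂ)
    (X : Matrix m m ℂ) (Y : Matrix n n ℂ) : tensorMap Φ Ψ (X ⊗ₖ Y) = Φ X ⊗ₖ Ψ Y := by
  simp [tensorMap]

/-- A Kraus representation `Φ X = tr_R (K X Kᴴ)` of a channel, with the Kraus operators stacked
into one matrix `K`. It is read off from a factorization of the Choi matrix. -/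
lemma IsChannel.exists_kraus {Φ : Matrix m m ℂ →ₗ[ℂ] Matrix n n ℂ} (hΦ : IsChannel Φ) :
    ∃ K : Matrix ((Fin (Fintype.card m) × n) × n) m ℂ, ∀ a b i j,
      Φ (single a b 1) i j = ∑ q, K (q, i) a * star (K (q, j) b) := by
  let e := Fintype.equivFin m
  let k := Fintype.card m
  -- The unnormalized maximally entangled state on `Fin k × m`.
  let v : Fin k × m → ℂ := fun x => if x.1 = e x.2 then 1 else 0
  have hX : vecMulVec v (star v) =
      ∑ a, ∑ b, (single (e a) (e b) (1 : ℂ)) ⊗ₖ (single a b (1 : ℂ)) := by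
    ext ⟨r, a⟩ ⟨s, b⟩
    simp only [vecMulVec_apply, Pi.star_apply, Matrix.sum_apply, kroneckerMap_apply,
      single_apply, v]
    rw [Finset.sum_eq_single a, Finset.sum_eq_single b]
    · by_cases h1 : r = e a <;> by_cases h2 : s = e b <;> simp [h1, h2, eq_comm]
    · intro c _ hc; simp [hc]
    · simp
    · intro c _ hc; simp [hc]
    · simp
  have hpos := hΦ.completelyPositive k _ (posSemidef_vecMulVec_self_star v)
  open scoped MatrixOrder in
  obtain ⟨L, hL⟩ := CStarAlgebra.nonneg_iff_eq_star_mul_self.1 hpos.nonneg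
  refine ⟨Matrix.of fun x a => star (L x.1 (e a, x.2)), fun a b i j => ?_⟩
  have h := congrFun (congrFun hL (e a, i)) (e b, j)
  rw [hX] at h
  simp only [map_sum, tensorMap_kronecker, LinearMap.id_apply, Matrix.sum_apply,
    kroneckerMap_apply] at h
  rw [Finset.sum_eq_single a, Finset.sum_eq_single b] at h
  · simpa [mul_apply] using h
  · intro c _ hc; simp [hc]
  · simp
  · intro c _ hc; simp [hc]
  · simp

/-- The dual (Heisenberg picture) of a channel is unital, preserves Hermitian matrices and
satisfies the Kadison–Schwarz inequality `F(A)² ≤ F(A²)`. -/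
theorem IsChannel.exists_dual {Φ : Matrix m m ℂ →ₗ[ℂ] Matrix n n ℂ} (hΦ : IsChannel Φ) :
    ∃ F : Matrix n n ℂ → Matrix m m ℂ, (∀ A X, (A * Φ X).trace = (F A * X).trace) ∧ F 1 = 1 ∧
      (∀ A, A.IsHermitian → (F A).IsHermitian) ∧
      ∀ A, A.IsHermitian → (F (A * A) - F A * F A).PosSemidef := by
  obtain ⟨K, hK⟩ := hΦ.exists_kraus
  set F : Matrix n n ℂ → Matrix m m ℂ :=
    fun A => Kᴴ * inSnd (Fin (Fintype.card m) × n) A * K with hF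
  have hdual : ∀ A X, (A * Φ X).trace = (F A * X).trace := by
    intro A X
    induction X using Matrix.induction_on' with
    | h_zero => simp
    | h_add X Y hX hY => simp [mul_add, hX, hY]
    | h_std_basis a b c =>
      have hc : single a b c = c • single a b (1 : ℂ) := by simp
      rw [hc, map_smul, Matrix.mul_smul, Matrix.mul_smul, trace_smul, trace_smul]
      congr 1
      have hFab : F A b a = ∑ q, ∑ j, ∑ i, star (K (q, i) b) * A i j * K (q, j) a := by
        simp only [hF]
        rw [mul_apply, Fintype.sum_prod_type]
        refine Finset.sum_congr rfl fun q _ => Finset.sum_congr rfl fun j _ => ?_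
        rw [mul_apply, Fintype.sum_prod_type, Finset.sum_eq_single q, Finset.sum_mul]
        · simp [inSnd_apply]
        · intro r _ hr
          simp [inSnd_apply, hr]
        · simp
      rw [trace_mul_single, op_smul_eq_mul, mul_one, hFab]
      simp only [trace, diag_apply, mul_apply, hK, Finset.mul_sum]
      rw [Finset.sum_congr rfl fun i _ => Finset.sum_comm, Finset.sum_comm]
      refine Finset.sum_congr rfl fun q _ => ?_
      rw [Finset.sum_comm]
      refine Finset.sum_congr rfl fun j _ => Finset.sum_congr rfl fun i _ => ?_
      ring
  have h1 : F 1 = 1 := by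
    rw [ext_iff_trace_mul_right]
    intro X
    rw [← hdual, Matrix.one_mul, Matrix.one_mul, hΦ.tracePreserving]
  have hKK : Kᴴ * K = 1 := by simpa [hF] using h1
  refine ⟨F, hdual, h1, fun A hA => ?_, fun A hA => ?_⟩
  · exact isHermitian_conjTranspose_mul_mul K (isHermitian_inSnd hA)
  · set T := inSnd (Fin (Fintype.card m) × n) A with hT
    have hTH : Tᴴ = T := isHermitian_inSnd hA
    have hsq : F (A * A) - F A * F A = (T * K - K * (Kᴴ * (T * K)))ᴴ *
        (T * K - K * (Kᴴ * (T * K))) := by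
      have h2 : ∀ Y : Matrix m m ℂ, Kᴴ * (K * Y) = Y := fun Y => by
        rw [← Matrix.mul_assoc, hKK, Matrix.one_mul]
      simp only [hF, inSnd_mul, ← hT, conjTranspose_sub, conjTranspose_mul, hTH,
        conjTranspose_conjTranspose, Matrix.sub_mul, Matrix.mul_sub, Matrix.mul_assoc, h2]
      abel
    rw [hsq]
    exact posSemidef_conjTranspose_mul_self _

lemma trace_kronecker_mul_tensorMap {m' n' : Type*} [Fintype m'] [Fintype n'] [DecidableEq m']
    [DecidableEq n'] {Φ : Matrix m m ℂ →ₗ[ℂ] Matrix m' m' ℂ}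
    {Ψ : Matrix n n ℂ →ₗ[ℂ] Matrix n' n' ℂ} {A : Matrix m' m' ℂ} {A' : Matrix m m ℂ}
    {B : Matrix n' n' ℂ} {B' : Matrix n n ℂ} (hA : ∀ X, (A * Φ X).trace = (A' * X).trace)
    (hB : ∀ X, (B * Ψ X).trace = (B' * X).trace) (X : Matrix (m × n) (m × n) ℂ) :
    ((A ⊗ₖ B) * tensorMap Φ Ψ X).trace = ((A' ⊗ₖ B') * X).trace := by
  induction X using kronecker_induction with
  | kron P Q => simp [← mul_kronecker_mul, trace_kronecker, hA, hB]
  | add X Y hX hY => simp [mul_add, hX, hY]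

end Channel

/-! ### The basic triangle network -/

section Triangle
variable {A₁ A₂ B₁ B₂ C₁ C₂ : Type*} [Fintype A₁] [Fintype A₂] [Fintype B₁] [Fintype B₂]
  [Fintype C₁] [Fintype C₂] [DecidableEq A₁] [DecidableEq A₂] [DecidableEq B₁] [DecidableEq B₂]
  [DecidableEq C₁] [DecidableEq C₂] {ρb : Matrix (C₂ × A₁) (C₂ × A₁) ℂ}
  {ρc : Matrix (A₂ × B₁) (A₂ × B₁) ℂ} {ρa : Matrix (B₂ × C₁) (B₂ × C₁) ℂ}

/-- The regrouping of the six systems from parties to sources. -/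
def regroup : (A₁ × A₂) × (B₁ × B₂) × (C₁ × C₂) ≃ (C₂ × A₁) × (A₂ × B₁) × (B₂ × C₁) where
  toFun x := ((x.2.2.2, x.1.1), (x.1.2, x.2.1.1), (x.2.1.2, x.2.2.1))
  invFun y := ((y.1.2, y.2.1.1), (y.2.1.2, y.2.2.1), (y.2.2.2, y.1.1))
  left_inv _ := rfl
  right_inv _ := rfl

/-- On product observables the network state factors over the three sources. -/
lemma expectation_btnState_kronecker (P₁ : Matrix A₁ A₁ ℂ) (P₂ : Matrix A₂ A₂ ℂ)
    (Q₁ : Matrix B₁ B₁ ℂ) (Q₂ : Matrix B₂ B₂ ℂ) (R₁ : Matrix C₁ C₁ ℂ) (R₂ : Matrix C₂ C₂ ℂ) :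
    expectation (btnState ρb ρc ρa) ((P₁ ⊗ₖ P₂) ⊗ₖ ((Q₁ ⊗ₖ Q₂) ⊗ₖ (R₁ ⊗ₖ R₂))) =
      expectation ρb (R₂ ⊗ₖ P₁) * (expectation ρc (P₂ ⊗ₖ Q₁) * expectation ρa (Q₂ ⊗ₖ R₁)) := by
  have h : (P₁ ⊗ₖ P₂) ⊗ₖ ((Q₁ ⊗ₖ Q₂) ⊗ₖ (R₁ ⊗ₖ R₂)) =
      ((R₂ ⊗ₖ P₁) ⊗ₖ ((P₂ ⊗ₖ Q₁) ⊗ₖ (Q₂ ⊗ₖ R₁))).submatrix regroup regroup := by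
    ext x y
    simp only [regroup, kroneckerMap_apply, submatrix_apply, Equiv.coe_fn_mk]
    ring
  have hb : btnState ρb ρc ρa = (ρb ⊗ₖ (ρc ⊗ₖ ρa)).submatrix regroup regroup := rfl
  simp only [expectation_apply, h, hb]
  rw [submatrix_mul_equiv, ← mul_kronecker_mul, ← mul_kronecker_mul, ← trace_kronecker,
    ← trace_kronecker]
  exact Equiv.sum_comp regroup fun y =>
    (((R₂ ⊗ₖ P₁) * ρb) ⊗ₖ (((P₂ ⊗ₖ Q₁) * ρc) ⊗ₖ ((Q₂ ⊗ₖ R₁) * ρa))) y y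

lemma isDensityMatrix_btnState (hb : IsDensityMatrix ρb) (hc : IsDensityMatrix ρc)
    (ha : IsDensityMatrix ρa) : IsDensityMatrix (btnState ρb ρc ρa) where
  posSemidef := (hb.posSemidef.kronecker (hc.posSemidef.kronecker ha.posSemidef)).submatrix _
  trace_eq_one := by
    have h := expectation_btnState_kronecker (ρb := ρb) (ρc := ρc) (ρa := ρa) 1 1 1 1 1 1
    simpa [one_kronecker_one, hb.trace_eq_one, hc.trace_eq_one, ha.trace_eq_one] using h

/-- The two systems held by one party come from different sources, so their joint state is a
product. -/
lemma reduce_btnState_A (ha : IsDensityMatrix ρa) (P : Matrix A₁ A₁ ℂ) (Q : Matrix A₂ A₂ ℂ) :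
    reduceFst (expectation (btnState ρb ρc ρa)) (P ⊗ₖ Q) =
      reduceSnd (expectation ρb) P * reduceFst (expectation ρc) Q := by
  have h := expectation_btnState_kronecker (ρb := ρb) (ρc := ρc) (ρa := ρa) P Q 1 1 1 1
  simp only [one_kronecker_one, ha.isState.map_one, mul_one] at h
  exact h

lemma reduce_btnState_B (hb : IsDensityMatrix ρb) (P : Matrix B₁ B₁ ℂ) (Q : Matrix B₂ B₂ ℂ) :
    reduceFst (reduceSnd (expectation (btnState ρb ρc ρa))) (P ⊗ₖ Q) =
      reduceSnd (expectation ρc) P * reduceFst (expectation ρa) Q := by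
  have h := expectation_btnState_kronecker (ρb := ρb) (ρc := ρc) (ρa := ρa) 1 1 P Q 1 1
  simp only [one_kronecker_one, hb.isState.map_one, one_mul] at h
  exact h

lemma reduce_btnState_C (hc : IsDensityMatrix ρc) (P : Matrix C₁ C₁ ℂ) (Q : Matrix C₂ C₂ ℂ) :
    reduceSnd (reduceSnd (expectation (btnState ρb ρc ρa))) (P ⊗ₖ Q) =
      reduceSnd (expectation ρa) P * reduceFst (expectation ρb) Q := by
  have h := expectation_btnState_kronecker (ρb := ρb) (ρc := ρc) (ρa := ρa) 1 1 1 1 P Q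
  simp only [one_kronecker_one, hc.isState.map_one, one_mul, mul_comm (expectation ρb _)] at h
  exact h

/-- Observables of the parties `A` and `B` are correlated only through the source `ρ_c`. -/
lemma expectation_btnState_AB (P : Matrix (A₁ × A₂) (A₁ × A₂) ℂ)
    (Q : Matrix (B₁ × B₂) (B₁ × B₂) ℂ) :
    expectation (btnState ρb ρc ρa) (P ⊗ₖ (Q ⊗ₖ 1)) =
      expectation ρc (condSnd (reduceSnd (expectation ρb)) P ⊗ₖ
        condFst (reduceFst (expectation ρa)) Q) := by
  induction P using kronecker_induction with
  | add X Y hX hY => simp only [add_kronecker, map_add, hX, hY]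
  | kron P₁ P₂ =>
    induction Q using kronecker_induction with
    | add X Y hX hY => simp only [add_kronecker, kronecker_add, map_add, hX, hY]
    | kron Q₁ Q₂ =>
      rw [← one_kronecker_one (m := C₁) (n := C₂), expectation_btnState_kronecker,
        condSnd_kronecker, condFst_kronecker, smul_kronecker, kronecker_smul, map_smul, map_smul,
        reduceFst_apply, reduceSnd_apply, inFst_apply, inSnd_apply, smul_eq_mul, smul_eq_mul]
      ring

/-- Observables of the parties `A` and `C` are correlated only through the source `ρ_b`. -/
lemma expectation_btnState_AC (P : Matrix (A₁ × A₂) (A₁ × A₂) ℂ)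
    (R : Matrix (C₁ × C₂) (C₁ × C₂) ℂ) :
    expectation (btnState ρb ρc ρa) (P ⊗ₖ (1 ⊗ₖ R)) =
      expectation ρb (condSnd (reduceSnd (expectation ρa)) R ⊗ₖ
        condFst (reduceFst (expectation ρc)) P) := by
  induction P using kronecker_induction with
  | add X Y hX hY => simp only [add_kronecker, kronecker_add, map_add, hX, hY]
  | kron P₁ P₂ =>
    induction R using kronecker_induction with
    | add X Y hX hY => simp only [add_kronecker, kronecker_add, map_add, hX, hY]
    | kron R₁ R₂ =>
      rw [← one_kronecker_one (m := B₁) (n := B₂), expectation_btnState_kronecker,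
        condSnd_kronecker, condFst_kronecker, smul_kronecker, kronecker_smul, map_smul, map_smul,
        reduceFst_apply, reduceSnd_apply, inFst_apply, inSnd_apply, smul_eq_mul, smul_eq_mul]
      ring

/-- Observables of the parties `B` and `C` are correlated only through the source `ρ_a`. -/
lemma expectation_btnState_BC (Q : Matrix (B₁ × B₂) (B₁ × B₂) ℂ)
    (R : Matrix (C₁ × C₂) (C₁ × C₂) ℂ) :
    expectation (btnState ρb ρc ρa) (1 ⊗ₖ (Q ⊗ₖ R)) =
      expectation ρa (condSnd (reduceSnd (expectation ρc)) Q ⊗ₖ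
        condFst (reduceFst (expectation ρb)) R) := by
  induction Q using kronecker_induction with
  | add X Y hX hY => simp only [add_kronecker, kronecker_add, map_add, hX, hY]
  | kron Q₁ Q₂ =>
    induction R using kronecker_induction with
    | add X Y hX hY => simp only [kronecker_add, map_add, hX, hY]
    | kron R₁ R₂ =>
      rw [← one_kronecker_one (m := A₁) (n := A₂), expectation_btnState_kronecker,
        condSnd_kronecker, condFst_kronecker, smul_kronecker, kronecker_smul, map_smul, map_smul,
        reduceFst_apply, reduceSnd_apply, inFst_apply, inSnd_apply, smul_eq_mul, smul_eq_mul]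
      ring

end Triangle

/-! ### The trace inequality -/

/-- The variance of an observable after a channel is at least the variance of its Heisenberg
picture image before the channel. -/
lemma IsState.cov_le_of_schwarz {m n : Type*} [Fintype m] [Fintype n] [DecidableEq m]
    {φ : Matrix m m ℂ →ₗ[ℂ] ℂ} (hφ : IsState φ) {ψ : Matrix n n ℂ →ₗ[ℂ] ℂ}
    {F : Matrix n n ℂ → Matrix m m ℂ} (hF : ∀ A, ψ A = φ (F A)) {A : Matrix n n ℂ}
    (hA : (F (A * A) - F A * F A).PosSemidef) : cov φ (F A) (F A) ≤ cov ψ A A := by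
  have h := hφ.nonneg_of_posSemidef hA
  rw [map_sub] at h
  rw [cov, cov, hF, hF]
  exact sub_le_sub_right (sub_nonneg.1 h) _

end TriangleNetwork

theorem proposition6 {α β γ ι κ μ : Type*}
    [Fintype α] [Fintype β] [Fintype γ] [DecidableEq α] [DecidableEq β] [DecidableEq γ]
    [Fintype ι] [Fintype κ] [Fintype μ] [DecidableEq κ] [DecidableEq μ]
    (ρ : Matrix (α × β × γ) (α × β × γ) ℂ) (hρ : IsCTNState ρ)
    (A : ι → Matrix α α ℂ) (B : κ → Matrix β β ℂ) (C : μ → Matrix γ γ ℂ)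
    (hA : ∀ i, (A i).IsHermitian) (hB : ∀ j, (B j).IsHermitian) (hC : ∀ k, (C k).IsHermitian)
    (Γ : Matrix (ι ⊕ κ ⊕ μ) (ι ⊕ κ ⊕ μ) ℂ) (hΓ : Γ = covMatrix (localObservables A B C) ρ) :
    Γ.trace.im = 0 ∧
      2 * traceNorm (blockE Γ) + 2 * traceNorm (blockF Γ) + 2 * traceNorm (blockG Γ) ≤
        Γ.trace.re := by
  obtain ⟨a₁, a₂, b₁, b₂, c₁, c₂, ρb, ρc, ρa, EA, EB, EC, hb, hc, ha, hEA, hEB, hEC, hρ⟩ := hρ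
  obtain ⟨FA, hFA, hFA1, hFAH, hFAS⟩ := hEA.exists_dual
  obtain ⟨FB, hFB, hFB1, hFBH, hFBS⟩ := hEB.exists_dual
  obtain ⟨FC, hFC, hFC1, hFCH, hFCS⟩ := hEC.exists_dual
  set ω := expectation (btnState ρb ρc ρa) with hω
  have hωs : IsState ω := (isDensityMatrix_btnState hb hc ha).isState
  have hdual : ∀ X Y Z, expectation ρ (X ⊗ₖ (Y ⊗ₖ Z)) = ω (FA X ⊗ₖ (FB Y ⊗ₖ FC Z)) := by
    intro X Y Z
    rw [hω, expectation_apply, expectation_apply, hρ]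
    exact trace_kronecker_mul_tensorMap (hFA X)
      (trace_kronecker_mul_tensorMap (hFB Y) (hFC Z)) _
  have hdA : ∀ X, reduceFst (expectation ρ) X = reduceFst ω (FA X) := fun X => by
    have h := hdual X 1 1
    rw [hFB1, hFC1, Matrix.one_kronecker_one, Matrix.one_kronecker_one] at h
    exact h
  have hdB : ∀ X, reduceFst (reduceSnd (expectation ρ)) X = reduceFst (reduceSnd ω) (FB X) :=
    fun X => by
      have h := hdual 1 X 1
      rw [hFA1, hFC1] at h
      exact h
  have hdC : ∀ X, reduceSnd (reduceSnd (expectation ρ)) X = reduceSnd (reduceSnd ω) (FC X) :=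
    fun X => by
      have h := hdual 1 1 X
      rw [hFA1, hFB1] at h
      exact h
  -- The partial expectations of the observables of each party over its two systems.
  set pA : ι → _ := fun i => condFst (reduceFst (expectation ρc)) (FA (A i))
  set qA : ι → _ := fun i => condSnd (reduceSnd (expectation ρb)) (FA (A i))
  set pB : κ → _ := fun j => condFst (reduceFst (expectation ρa)) (FB (B j))
  set qB : κ → _ := fun j => condSnd (reduceSnd (expectation ρc)) (FB (B j))
  set pC : μ → _ := fun k => condFst (reduceFst (expectation ρb)) (FC (C k))
  set qC : μ → _ := fun k => condSnd (reduceSnd (expectation ρa)) (FC (C k))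
  have hpAH : ∀ i, (pA i).IsHermitian := fun i =>
    hc.isState.reduceFst.isHermitian_condFst (hFAH _ (hA i))
  have hqAH : ∀ i, (qA i).IsHermitian := fun i =>
    hb.isState.reduceSnd.isHermitian_condSnd (hFAH _ (hA i))
  have hpBH : ∀ j, (pB j).IsHermitian := fun j =>
    ha.isState.reduceFst.isHermitian_condFst (hFBH _ (hB j))
  have hqBH : ∀ j, (qB j).IsHermitian := fun j =>
    hc.isState.reduceSnd.isHermitian_condSnd (hFBH _ (hB j))
  have hpCH : ∀ k, (pC k).IsHermitian := fun k =>
    hb.isState.reduceFst.isHermitian_condFst (hFCH _ (hC k))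
  have hqCH : ∀ k, (qC k).IsHermitian := fun k =>
    ha.isState.reduceSnd.isHermitian_condSnd (hFCH _ (hC k))
  have hVA : ∀ i, cov (expectation ρb) (inSnd _ (pA i)) (inSnd _ (pA i)) +
      cov (expectation ρc) (inFst _ (qA i)) (inFst _ (qA i)) ≤
      cov (reduceFst (expectation ρ)) (A i) (A i) := fun i => by
    rw [← cov_reduceFst, ← cov_reduceSnd]
    exact (hωs.reduceFst.cov_condFst_add_cov_condSnd_le hb.isState.reduceSnd
      hc.isState.reduceFst (reduce_btnState_A ha) (hFAH _ (hA i))).trans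
      (hωs.reduceFst.cov_le_of_schwarz hdA (hFAS _ (hA i)))
  have hVB : ∀ j, cov (expectation ρc) (inSnd _ (pB j)) (inSnd _ (pB j)) +
      cov (expectation ρa) (inFst _ (qB j)) (inFst _ (qB j)) ≤
      cov (reduceFst (reduceSnd (expectation ρ))) (B j) (B j) := fun j => by
    rw [← cov_reduceFst, ← cov_reduceSnd]
    exact (hωs.reduceSnd.reduceFst.cov_condFst_add_cov_condSnd_le hc.isState.reduceSnd
      ha.isState.reduceFst (reduce_btnState_B hb) (hFBH _ (hB j))).trans
      (hωs.reduceSnd.reduceFst.cov_le_of_schwarz hdB (hFBS _ (hB j)))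
  have hVC : ∀ k, cov (expectation ρa) (inSnd _ (pC k)) (inSnd _ (pC k)) +
      cov (expectation ρb) (inFst _ (qC k)) (inFst _ (qC k)) ≤
      cov (reduceSnd (reduceSnd (expectation ρ))) (C k) (C k) := fun k => by
    rw [← cov_reduceFst, ← cov_reduceSnd]
    exact (hωs.reduceSnd.reduceSnd.cov_condFst_add_cov_condSnd_le ha.isState.reduceSnd
      hb.isState.reduceFst (reduce_btnState_C hc) (hFCH _ (hC k))).trans
      (hωs.reduceSnd.reduceSnd.cov_le_of_schwarz hdC (hFCS _ (hC k)))
  -- Each off-diagonal block is the cross-covariance of partial expectations in one source.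
  have hE : blockE Γ = Matrix.of fun i j =>
      cov (expectation ρc) (inFst _ (qA i)) (inSnd _ (pB j)) := by
    have h : ∀ X Y, expectation ρ (X ⊗ₖ (Y ⊗ₖ 1)) = expectation ρc
        (condSnd (reduceSnd (expectation ρb)) (FA X) ⊗ₖ
          condFst (reduceFst (expectation ρa)) (FB Y)) := fun X Y => by
      rw [hdual, hFC1, hω, expectation_btnState_AB]
    ext i j
    have h1 := h (A i) 1
    have h2 := h 1 (B j)
    rw [hFB1, ha.isState.reduceFst.condFst_one] at h1
    rw [hFA1, hb.isState.reduceSnd.condSnd_one] at h2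
    rw [Matrix.of_apply, cov, inFst_mul_inSnd, inFst_apply, inSnd_apply, ← h, ← h1, ← h2, hΓ]
    simp [blockE, covMatrix, localObservables, expect, ← Matrix.mul_kronecker_mul]
  have hF : blockF Γ = Matrix.of fun i k =>
      cov (expectation ρb) (inSnd _ (pA i)) (inFst _ (qC k)) := by
    have h : ∀ X Z, expectation ρ (X ⊗ₖ (1 ⊗ₖ Z)) = expectation ρb
        (condSnd (reduceSnd (expectation ρa)) (FC Z) ⊗ₖ
          condFst (reduceFst (expectation ρc)) (FA X)) := fun X Z => by
      rw [hdual, hFB1, hω, expectation_btnState_AC]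
    ext i k
    have h1 := h (A i) 1
    have h2 := h 1 (C k)
    rw [hFC1, ha.isState.reduceSnd.condSnd_one] at h1
    rw [hFA1, hc.isState.reduceFst.condFst_one] at h2
    rw [Matrix.of_apply, cov, inSnd_mul_inFst, inFst_apply, inSnd_apply, ← h, ← h1, ← h2, hΓ]
    simp [blockF, covMatrix, localObservables, expect, ← Matrix.mul_kronecker_mul]
  have hG : blockG Γ = Matrix.of fun j k =>
      cov (expectation ρa) (inFst _ (qB j)) (inSnd _ (pC k)) := by
    have h : ∀ Y Z, expectation ρ (1 ⊗ₖ (Y ⊗ₖ Z)) = expectation ρa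
        (condSnd (reduceSnd (expectation ρc)) (FB Y) ⊗ₖ
          condFst (reduceFst (expectation ρb)) (FC Z)) := fun Y Z => by
      rw [hdual, hFA1, hω, expectation_btnState_BC]
    ext j k
    have h1 := h (B j) 1
    have h2 := h 1 (C k)
    rw [hFC1, hb.isState.reduceFst.condFst_one] at h1
    rw [hFB1, hc.isState.reduceSnd.condSnd_one] at h2
    rw [Matrix.of_apply, cov, inFst_mul_inSnd, inFst_apply, inSnd_apply, ← h, ← h1, ← h2, hΓ]
    simp [blockG, covMatrix, localObservables, expect, ← Matrix.mul_kronecker_mul]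
  have hT : Γ.trace = ∑ i, cov (reduceFst (expectation ρ)) (A i) (A i) +
      (∑ j, cov (reduceFst (reduceSnd (expectation ρ))) (B j) (B j) +
        ∑ k, cov (reduceSnd (reduceSnd (expectation ρ))) (C k) (C k)) := by
    rw [hΓ, Matrix.trace, Fintype.sum_sum_type, Fintype.sum_sum_type]
    simp only [cov_reduceFst, cov_reduceSnd]
    simp only [inFst_apply, inSnd_apply, ← Matrix.one_kronecker_one (m := β) (n := γ)]
    rfl
  have bE := hc.isState.two_mul_traceNorm_cov_le (fun i => isHermitian_inFst (n := Fin b₁) (hqAH i))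
    (fun j => isHermitian_inSnd (m := Fin a₂) (hpBH j))
  have bF := hb.isState.two_mul_traceNorm_cov_le (fun i => isHermitian_inSnd (m := Fin c₂) (hpAH i))
    (fun k => isHermitian_inFst (n := Fin a₁) (hqCH k))
  have bG := ha.isState.two_mul_traceNorm_cov_le (fun j => isHermitian_inFst (n := Fin c₁) (hqBH j))
    (fun k => isHermitian_inSnd (m := Fin b₂) (hpCH k))
  rw [← hE] at bE
  rw [← hF] at bF
  rw [← hG] at bG
  have sA := Finset.sum_le_sum fun i (_ : i ∈ Finset.univ) => hVA i
  have sB := Finset.sum_le_sum fun j (_ : j ∈ Finset.univ) => hVB j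
  have sC := Finset.sum_le_sum fun k (_ : k ∈ Finset.univ) => hVC k
  rw [Finset.sum_add_distrib] at sA sB sC
  have key : ((2 * traceNorm (blockE Γ) + 2 * traceNorm (blockF Γ) + 2 * traceNorm (blockG Γ) : ℝ)
      : ℂ) ≤ Γ.trace := by
    rw [hT]
    push_cast
    refine (add_le_add (add_le_add bE bF) bG).trans (le_trans (le_of_eq ?_)
      (add_le_add sA (add_le_add sB sC)))
    ring
  rw [Complex.le_def] at key
  exact ⟨by simpa using key.2.symm, by simpa using key.1⟩
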